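/- Let $\mathcal{A}$ be an alphabet with exactly $4$ letters. A word over $\mathcal{A}$ is a finite sequence of letters of $\mathcal{A}$. A word is square-free if it cannot be written as $PXXS$ with words $P,X,S$, where $X$ is nonempty ($P$ and $S$ may be empty). A square-free word is steady if every word obtained from it by deleting the letter at any single position is again square-free. Then there exist arbitrarily long steady words over $\mathcal{A}$: for every natural number $N$ there is a steady word over $\mathcal{A}$ of length at least $N$. -/

import Mathlib

/-- A word (a finite list of letters) contains a square if it can be written as `P X X S`
with `X` nonempty, while `P` and `S` are possibly empty. -/
def ContainsSquare {A : Type*} (w : List A) : Prop :=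
  ∃ P X S : List A, X ≠ [] ∧ w = P ++ X ++ X ++ S

/-- A word is square-free if it contains no square. -/
def IsSquareFreeWord {A : Type*} (w : List A) : Prop :=
  ¬ ContainsSquare w

/-- `v` is a reduction of `w` if it arises from `w` by deleting the letter at one position
(possibly the first or the last one). -/
def IsReduction {A : Type*} (v w : List A) : Prop :=
  ∃ (P : List A) (x : A) (S : List A), w = P ++ [x] ++ S ∧ v = P ++ S

/-- A square-free word is steady if it remains square-free after deleting any single letter. -/
def IsSteady {A : Type*} (w : List A) : Prop :=
  IsSquareFreeWord w ∧ ∀ v : List A, IsReduction v w → IsSquareFreeWord v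

/-! The word is the image of Leech's square-free ternary word under a 35-uniform morphism. A square
of half-length `n` created by deleting a letter from its left (right) half is a run of `s`
agreements at lag `n + 1` (`n`), then `n - s` at lag `n` (`n + 1`).

Any 11 consecutive agreements force the lag to be a multiple of 35 (`steadySeq_dvd`), so two long
runs are incompatible. One long run whose lag barely exceeds its length pulls back to a square in
Leech's word (`steadySeq_no_long_repetition`). The cases `n < 21` are a finite check on images of
three letters. -/

/-- Rotation of the letters `0, 1, 2` by `a`; larger letters are fixed. -/
def letterShift (x a : ℕ) : ℕ := if x < 3 then (x + a) % 3 else x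

/-- The image of the sequence `u` under the `q`-uniform morphism sending `a` to the block
`letterShift (c 0) a, …, letterShift (c (q - 1)) a`. -/
def substWord (q : ℕ) (c u : ℕ → ℕ) (i : ℕ) : ℕ := letterShift (c (i % q)) (u (i / q))

/-- The sequence beginning with `a, b, d` and continuing with `d`. -/
def triple (a b d : ℕ) : ℕ → ℕ
  | 0 => a
  | 1 => b
  | _ => d

/-- The `i`-th base `4` digit of `n`. -/
def digit (n i : ℕ) : ℕ := n / 4 ^ i % 4

/-- The block `0121021201210` generating Leech's square-free ternary morphism, with its letters
read from the base `4` digits of a number. -/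
def leechBlock (i : ℕ) : ℕ := digit 6592612 i

/-- The block `01203213023103201231021320312302103` generating a morphism from square-free ternary
words to steady words, with its letters read from the base `4` digits of a number. -/
def steadyBlock (i : ℕ) : ℕ := digit 914154964127447571236 i

/-- The fixed point of Leech's morphism. -/
def leechWord (i : ℕ) : ℕ :=
  if i = 0 then 0 else letterShift (leechBlock (i % 13)) (leechWord (i / 13))
decreasing_by omega

/-- A sequence over the letters `0, 1, 2, 3` all of whose factors are steady. -/
def steadySeq : ℕ → ℕ := substWord 35 steadyBlock leechWord

/-! ### Computable comparison of windows -/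

/-- The length, capped at `l`, of the longest common prefix of `v` from position `i` on and `w`
from position `j` on. -/
def commonPrefix (v w : ℕ → ℕ) : ℕ → ℕ → ℕ → ℕ
  | 0, _, _ => 0
  | l + 1, i, j => if v i = w j then commonPrefix v w l (i + 1) (j + 1) + 1 else 0

theorem commonPrefix_le (v w : ℕ → ℕ) (l i j : ℕ) : commonPrefix v w l i j ≤ l := by
  induction l generalizing i j with
  | zero => simp [commonPrefix]
  | succ l ih =>
    rw [commonPrefix]
    split_ifs
    · exact Nat.succ_le_succ (ih _ _)
    · omega

theorem le_commonPrefix {v w : ℕ → ℕ} {l i j s : ℕ} (hs : s ≤ l)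
    (h : ∀ t < s, v (i + t) = w (j + t)) : s ≤ commonPrefix v w l i j := by
  induction l generalizing i j s with
  | zero => omega
  | succ l ih =>
    obtain _ | s := s
    · omega
    · rw [commonPrefix, if_pos (by simpa using h 0 (by omega))]
      refine Nat.succ_le_succ (ih (by omega) fun t ht => ?_)
      convert h (t + 1) (by omega) using 2 <;> omega

/-- Starting at position `i`, count greedily how many of `n` letters repeat at distance `p`, then
skip `g` letters, and count how many of the remaining ones repeat at distance `p'`. -/
def twoLagLength (w : ℕ → ℕ) (p p' g n i : ℕ) : ℕ :=
  commonPrefix w w n i (i + p) +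
    commonPrefix w w (n - commonPrefix w w n i (i + p)) (i + commonPrefix w w n i (i + p) + g)
      (i + commonPrefix w w n i (i + p) + g + p')

/-- Greedy choice loses nothing: lengthening the first run to its maximum only drops conditions from
the second. One evaluation thus covers every deletion position `s`. -/
theorem le_twoLagLength {w : ℕ → ℕ} {p p' g n i s : ℕ} (hs : s ≤ n)
    (h1 : ∀ t < s, w (i + t) = w (i + t + p))
    (h2 : ∀ t < n - s, w (i + s + g + t) = w (i + s + g + t + p')) :
    n ≤ twoLagLength w p p' g n i := by
  unfold twoLagLength
  have hr : s ≤ commonPrefix w w n i (i + p) := le_commonPrefix hs fun t ht => by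
    rw [h1 t ht]
    congr 1
    omega
  have hrn := commonPrefix_le w w n i (i + p)
  generalize commonPrefix w w n i (i + p) = r at hr hrn
  have h3 : n - r ≤ commonPrefix w w (n - r) (i + r + g) (i + r + g + p') :=
    le_commonPrefix le_rfl fun t ht => by
      convert h2 (r - s + t) (by omega) using 2 <;> omega
  omega

/-! ### Uniform morphisms and desubstitution -/

theorem letterShift_injective {x a b : ℕ} (hx : x < 3) (ha : a < 3) (hb : b < 3)
    (h : letterShift x a = letterShift x b) : a = b := by
  simp only [letterShift, hx, if_true] at h
  omega

theorem letterShift_lt {x a : ℕ} (hx : x < 4) : letterShift x a < 4 := by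
  unfold letterShift
  split_ifs <;> omega

theorem substWord_add {q : ℕ} (hq : 0 < q) (c u : ℕ → ℕ) (x m : ℕ) :
    substWord q c u (q * x + m) = substWord q c (fun i => u (x + i)) m := by
  simp [substWord, Nat.mul_add_div hq]

theorem substWord_eq_triple {q : ℕ} (hq : 0 < q) (c u : ℕ → ℕ) (x m : ℕ) (hm : m < 3 * q) :
    substWord q c u (q * x + m)
      = substWord q c (triple (u x) (u (x + 1)) (u (x + 2))) m := by
  rw [substWord_add hq]
  have h : m / q < 3 := Nat.div_lt_of_lt_mul (by linarith)
  unfold substWord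
  congr 1
  interval_cases m / q <;> rfl

/-- The third letter `0` is a filler, never read. -/
theorem substWord_eq_triple_two {q : ℕ} (hq : 0 < q) (c u : ℕ → ℕ) (x m : ℕ) (hm : m < 2 * q) :
    substWord q c u (q * x + m) = substWord q c (triple (u x) (u (x + 1)) 0) m := by
  rw [substWord_add hq]
  have h : m / q < 2 := Nat.div_lt_of_lt_mul (by linarith)
  unfold substWord
  congr 1
  interval_cases m / q <;> rfl

/-- A repetition in the image whose distance is a multiple of the block length comes from
a repetition in the preimage. -/
theorem eq_of_substWord_agree {q : ℕ} (hq : 2 ≤ q) {c u : ℕ → ℕ} (hu : ∀ i, u i < 3)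
    (hc : ∀ j, j + 1 < q → c j < 3 ∨ c (j + 1) < 3) (hc0 : c 0 < 3) {a k l : ℕ} (hl : 2 ≤ l)
    (h : ∀ t < l, substWord q c u (a + t) = substWord q c u (a + t + q * k))
    {x : ℕ} (hx : (a + 1) / q ≤ x) (hxl : q * x < a + l) : u x = u (x + k) := by
  have key : ∀ j < q, a ≤ q * x + j → q * x + j < a + l → c j < 3 → u x = u (x + k) := by
    intro j hj h1 h2 h3
    have h4 := h (q * x + j - a) (by omega)
    rw [show a + (q * x + j - a) = q * x + j by omega,
      show q * x + j + q * k = q * (x + k) + j by ring,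
      substWord_add (by omega), substWord_add (by omega)] at h4
    simp only [substWord, Nat.mod_eq_of_lt hj, Nat.div_eq_of_lt hj, add_zero] at h4
    exact letterShift_injective h3 (hu _) (hu _) h4
  by_cases ha : a ≤ q * x
  · exact key 0 (by omega) ha (by omega) hc0
  · have h1 : a + 1 < q * (x + 1) := by
      rw [mul_comm]
      exact (Nat.div_lt_iff_lt_mul (by omega)).1 (Nat.lt_succ_of_le hx)
    rw [mul_add, mul_one] at h1
    -- Positions `a` and `a + 1` both lie in block `x`, and one of them carries a rotated letter.
    rcases hc (a - q * x) (by omega) with h2 | h2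
    · exact key _ (by omega) (by omega) (by omega) h2
    · exact key _ (by omega) (by omega) (by omega) h2

/-- If the windows of length `l` of images of two-letter words determine their positions within
a block, then every repetition of length `l` in an image has distance divisible by the block
length. -/
theorem dvd_of_substWord_agree {q l : ℕ} (hl : l ≤ q) (hl0 : 0 < l) {c u : ℕ → ℕ}
    (hu : ∀ i, u i < 3) (hne : ∀ i, u i ≠ u (i + 1))
    (hsync : ∀ a < 3, ∀ b < 3, a ≠ b → ∀ a' < 3, ∀ b' < 3, a' ≠ b' → ∀ i < q, ∀ j < i,
      commonPrefix (substWord q c (triple a b 0)) (substWord q c (triple a' b' 0)) l i j < l)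
    {a p : ℕ}
    (h : ∀ t < l, substWord q c u (a + t) = substWord q c u (a + t + p)) : q ∣ p := by
  have hq : 0 < q := by omega
  have hi := Nat.mod_lt a hq
  have hj := Nat.mod_lt (a + p) hq
  have h0 : ∀ t < l, substWord q c (triple (u (a / q)) (u (a / q + 1)) 0) (a % q + t)
      = substWord q c (triple (u ((a + p) / q)) (u ((a + p) / q + 1)) 0) ((a + p) % q + t) := by
    intro t ht
    rw [← substWord_eq_triple_two hq _ _ _ _ (by omega),
      ← substWord_eq_triple_two hq _ _ _ _ (by omega), ← add_assoc, ← add_assoc,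
      Nat.div_add_mod, Nat.div_add_mod, h t ht]
    congr 1
    omega
  have h1 : a % q = (a + p) % q := by
    rcases lt_trichotomy (a % q) ((a + p) % q) with h1 | h1 | h1
    · exact absurd (le_commonPrefix le_rfl fun t ht => (h0 t ht).symm) (not_le.2
        (hsync _ (hu _) _ (hu _) (hne _) _ (hu _) _ (hu _) (hne _) _ hj _ h1))
    · exact h1
    · exact absurd (le_commonPrefix le_rfl h0) (not_le.2
        (hsync _ (hu _) _ (hu _) (hne _) _ (hu _) _ (hu _) (hne _) _ hi _ h1))
  have h2 : a ≡ a + p [MOD q] := h1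
  simpa using (Nat.modEq_iff_dvd' (Nat.le_add_right a p)).1 h2

/-! ### Leech's square-free word -/

theorem leechWord_eq_substWord (i : ℕ) : leechWord i = substWord 13 leechBlock leechWord i := by
  by_cases h : i = 0
  · subst h
    -- The value fixed at 0 is consistent because the block starts with `0`.
    simp [substWord, letterShift, leechBlock, digit, leechWord]
  · conv_lhs => rw [leechWord]
    simp [h, substWord]

theorem leechWord_eq : leechWord = substWord 13 leechBlock leechWord :=
  funext leechWord_eq_substWord

theorem leechBlock_lt (i : ℕ) : leechBlock i < 3 := by
  by_cases h : i < 13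
  · interval_cases i <;> decide
  · have h1 : 6592612 < 4 ^ i := lt_of_lt_of_le (by norm_num)
      (Nat.pow_le_pow_right (by norm_num) (not_lt.1 h))
    simp [leechBlock, digit, Nat.div_eq_of_lt h1]

theorem leechWord_lt (i : ℕ) : leechWord i < 3 := by
  rw [leechWord_eq_substWord, substWord, letterShift, if_pos (leechBlock_lt _)]
  exact Nat.mod_lt _ (by norm_num)

theorem leechWord_ne_succ (i : ℕ) : leechWord i ≠ leechWord (i + 1) := by
  induction i using Nat.strong_induction_on with
  | _ i ih =>
    rw [leechWord_eq_substWord, leechWord_eq_substWord (i + 1)]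
    have hm : i % 13 < 13 := Nat.mod_lt _ (by norm_num)
    unfold substWord
    by_cases h : i % 13 = 12
    · rw [show (i + 1) % 13 = 0 by omega, show (i + 1) / 13 = i / 13 + 1 by omega, h]
      intro h1
      -- The block starts and ends with `0`, so equality across a boundary descends to adjacent
      -- preimage letters.
      exact ih (i / 13) (by omega)
        (letterShift_injective (x := 0) (by norm_num) (leechWord_lt _) (leechWord_lt _) h1)
    · rw [show (i + 1) % 13 = i % 13 + 1 by omega, show (i + 1) / 13 = i / 13 by omega]
      have h2 : i % 13 < 12 := by omega
      have h3 := leechWord_lt (i / 13)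
      generalize leechWord (i / 13) = a at h3
      generalize i % 13 = j at h2
      revert a j
      decide +kernel

set_option synthInstance.maxSize 100000 in
theorem leechBlock_sync : ∀ a < 3, ∀ b < 3, a ≠ b → ∀ a' < 3, ∀ b' < 3, a' ≠ b' →
    ∀ i < 13, ∀ j < i, commonPrefix (substWord 13 leechBlock (triple a b 0))
      (substWord 13 leechBlock (triple a' b' 0)) 8 i j < 8 := by
  decide +kernel

set_option synthInstance.maxSize 100000 in
theorem leechBlock_short : ∀ a < 3, ∀ b < 3, a ≠ b → ∀ i < 13, ∀ n < 8, 1 ≤ n →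
    ¬ ∀ t < n, substWord 13 leechBlock (triple a b 0) (i + t)
      = substWord 13 leechBlock (triple a b 0) (i + t + n) := by
  decide +kernel

theorem leechWord_squareFree (n : ℕ) (hn : 1 ≤ n) (i : ℕ) :
    ¬ ∀ t < n, leechWord (i + t) = leechWord (i + t + n) := by
  induction n using Nat.strong_induction_on generalizing i with
  | _ n ih =>
    intro h
    rw [leechWord_eq] at h
    by_cases h8 : n < 8
    · refine leechBlock_short _ (leechWord_lt (i / 13)) _ (leechWord_lt (i / 13 + 1))
        (leechWord_ne_succ _) (i % 13) (Nat.mod_lt _ (by norm_num)) n h8 hn fun t ht => ?_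
      have hm : i % 13 < 13 := Nat.mod_lt _ (by norm_num)
      rw [← substWord_eq_triple_two (by norm_num) _ _ _ _ (by omega),
        ← substWord_eq_triple_two (by norm_num) _ _ _ _ (by omega)]
      convert h t ht using 2 <;> omega
    · obtain ⟨k, rfl⟩ := dvd_of_substWord_agree (l := 8) (by norm_num) (by norm_num) leechWord_lt
        leechWord_ne_succ leechBlock_sync (fun t ht => h t (by omega))
      -- Descent: a square of half-length `13 * k` comes from one of half-length `k`.
      refine ih k (by omega) (by omega) ((i + 1) / 13) fun t ht => ?_
      exact eq_of_substWord_agree (by norm_num) leechWord_lt (fun j _ => Or.inl (leechBlock_lt j))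
        (leechBlock_lt 0) (by omega) h (by omega) (by omega)

/-! ### The steady sequence -/

theorem steadyBlock_lt (i : ℕ) : steadyBlock i < 4 :=
  Nat.mod_lt _ (by norm_num)

theorem steadyBlock_consecutive : ∀ j < 34, steadyBlock j < 3 ∨ steadyBlock (j + 1) < 3 := by
  decide

theorem steadySeq_lt (i : ℕ) : steadySeq i < 4 :=
  letterShift_lt (steadyBlock_lt _)

set_option synthInstance.maxSize 100000 in
theorem steadyBlock_sync : ∀ a < 3, ∀ b < 3, a ≠ b → ∀ a' < 3, ∀ b' < 3, a' ≠ b' →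
    ∀ i < 35, ∀ j < i, commonPrefix (substWord 35 steadyBlock (triple a b 0))
      (substWord 35 steadyBlock (triple a' b' 0)) 11 i j < 11 := by
  decide +kernel

set_option synthInstance.maxSize 100000 in
/-- No short square arises in `steadySeq` by deleting a letter from the left half. -/
theorem steadyBlock_short_left : ∀ a < 3, ∀ b < 3, a ≠ b → ∀ d < 3, b ≠ d → ∀ i < 35, ∀ n < 21,
    1 ≤ n → twoLagLength (substWord 35 steadyBlock (triple a b d)) (n + 1) n 1 n i < n := by
  decide +kernel

set_option synthInstance.maxSize 100000 in
/-- No short square arises in `steadySeq` by deleting a letter from the right half. -/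
theorem steadyBlock_short_right : ∀ a < 3, ∀ b < 3, a ≠ b → ∀ d < 3, b ≠ d → ∀ i < 35, ∀ n < 21,
    1 ≤ n → twoLagLength (substWord 35 steadyBlock (triple a b d)) n (n + 1) 0 n i < n := by
  decide +kernel

theorem steadySeq_dvd {a p : ℕ} (h : ∀ t < 11, steadySeq (a + t) = steadySeq (a + t + p)) :
    35 ∣ p :=
  dvd_of_substWord_agree (by norm_num) (by norm_num) leechWord_lt leechWord_ne_succ
    steadyBlock_sync h

/-- `steadySeq` has no long repetition whose two occurrences are separated by a short gap. -/
theorem steadySeq_no_long_repetition {a p l : ℕ} (hl : 11 ≤ l) (hp : 1 ≤ p) (hpl : p ≤ l + 11) :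
    ¬ ∀ t < l, steadySeq (a + t) = steadySeq (a + t + p) := by
  intro h
  obtain ⟨k, rfl⟩ := steadySeq_dvd fun t ht => h t (by omega)
  -- The run has at least `35 * k - 11` letters, enough to determine `k` consecutive preimage
  -- letters.
  refine leechWord_squareFree k (by omega) ((a + 1) / 35) fun t ht => ?_
  exact eq_of_substWord_agree (q := 35) (by norm_num) leechWord_lt
    (fun j hj => steadyBlock_consecutive j (by omega)) (by decide) (by omega) h (by omega) (by omega)

theorem steadySeq_no_square_delete_left {n : ℕ} (hn : 1 ≤ n) (i s : ℕ) (hs : s ≤ n)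
    (h1 : ∀ t < s, steadySeq (i + t) = steadySeq (i + t + (n + 1)))
    (h2 : ∀ t < n - s, steadySeq (i + s + 1 + t) = steadySeq (i + s + 1 + t + n)) : False := by
  by_cases h : n < 21
  · have hm : i % 35 < 35 := Nat.mod_lt _ (by norm_num)
    unfold steadySeq at h1 h2
    refine (steadyBlock_short_left _ (leechWord_lt (i / 35)) _ (leechWord_lt (i / 35 + 1))
      (leechWord_ne_succ _) _ (leechWord_lt (i / 35 + 2)) (leechWord_ne_succ _) (i % 35) hm n h
      hn).not_ge (le_twoLagLength hs (fun t ht => ?_) fun t ht => ?_)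
    · rw [← substWord_eq_triple (by norm_num) _ _ _ _ (by omega),
        ← substWord_eq_triple (by norm_num) _ _ _ _ (by omega)]
      convert h1 t ht using 2 <;> omega
    · rw [← substWord_eq_triple (by norm_num) _ _ _ _ (by omega),
        ← substWord_eq_triple (by norm_num) _ _ _ _ (by omega)]
      convert h2 t ht using 2 <;> omega
  -- As `n ≥ 21`, one run has length at least 11. If both do, 35 divides `n` and `n + 1`; otherwise
  -- the other has at most 10, so the lag exceeds the long run by at most 11.
  · by_cases hs1 : 11 ≤ s
    · by_cases hs2 : 11 ≤ n - s
      · have := steadySeq_dvd fun t ht => h1 t (by omega)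
        have := steadySeq_dvd fun t ht => h2 t (by omega)
        omega
      · exact steadySeq_no_long_repetition hs1 (by omega) (by omega) h1
    · exact steadySeq_no_long_repetition (by omega) hn (by omega) h2

theorem steadySeq_no_square_delete_right {n : ℕ} (hn : 1 ≤ n) (i s : ℕ) (hs : s ≤ n)
    (h1 : ∀ t < s, steadySeq (i + t) = steadySeq (i + t + n))
    (h2 : ∀ t < n - s, steadySeq (i + s + t) = steadySeq (i + s + t + (n + 1))) : False := by
  by_cases h : n < 21
  · have hm : i % 35 < 35 := Nat.mod_lt _ (by norm_num)
    unfold steadySeq at h1 h2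
    refine (steadyBlock_short_right _ (leechWord_lt (i / 35)) _ (leechWord_lt (i / 35 + 1))
      (leechWord_ne_succ _) _ (leechWord_lt (i / 35 + 2)) (leechWord_ne_succ _) (i % 35) hm n h
      hn).not_ge (le_twoLagLength hs (fun t ht => ?_) fun t ht => ?_)
    · rw [← substWord_eq_triple (by norm_num) _ _ _ _ (by omega),
        ← substWord_eq_triple (by norm_num) _ _ _ _ (by omega)]
      convert h1 t ht using 2 <;> omega
    · rw [← substWord_eq_triple (by norm_num) _ _ _ _ (by omega),
        ← substWord_eq_triple (by norm_num) _ _ _ _ (by omega)]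
      convert h2 t ht using 2 <;> omega
  · by_cases hs1 : 11 ≤ s
    · by_cases hs2 : 11 ≤ n - s
      · have := steadySeq_dvd fun t ht => h1 t (by omega)
        have := steadySeq_dvd fun t ht => h2 t (by omega)
        omega
      · exact steadySeq_no_long_repetition hs1 (by omega) (by omega) h1
    · exact steadySeq_no_long_repetition (by omega) (by omega) (by omega) h2

theorem steadySeq_squareFree {n : ℕ} (hn : 1 ≤ n) (i : ℕ) :
    ¬ ∀ t < n, steadySeq (i + t) = steadySeq (i + t + n) := fun h =>
  -- With `s = n` the second run is empty.
  steadySeq_no_square_delete_right hn i n le_rfl h (by omega)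

/-! ### Transfer to lists -/

/-- A word containing a square repeats `n` consecutive letters at distance `n`. -/
theorem ContainsSquare.exists_getElem?_eq {A : Type*} {v : List A} (h : ContainsSquare v) :
    ∃ i n, 1 ≤ n ∧ i + 2 * n ≤ v.length ∧ ∀ t < n, v[i + t]? = v[i + t + n]? := by
  obtain ⟨P, X, S, hX, rfl⟩ := h
  refine ⟨P.length, X.length, List.length_pos_iff.2 hX, by simp; omega, fun t ht => ?_⟩
  simp only [List.append_assoc, add_assoc]
  rw [List.getElem?_append_right (Nat.le_add_right _ _),
    List.getElem?_append_right (Nat.le_add_right _ _), Nat.add_sub_cancel_left,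
    Nat.add_sub_cancel_left, List.getElem?_append_left ht,
    List.getElem?_append_right (Nat.le_add_left _ _), Nat.add_sub_cancel,
    List.getElem?_append_left ht]

theorem isSteady_map_steadySeq {A : Type*} (e : ℕ → A) (he : ∀ x < 4, ∀ y < 4, e x = e y → x = y)
    (N : ℕ) : IsSteady ((List.range N).map fun i => e (steadySeq i)) := by
  have hget : ∀ i j, i < N → j < N →
      ((List.range N).map fun i => e (steadySeq i))[i]?
        = ((List.range N).map fun i => e (steadySeq i))[j]? → steadySeq i = steadySeq j := by
    intro i j hi hj h
    simp only [List.getElem?_map, List.getElem?_range hi, List.getElem?_range hj,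
      Option.map_some, Option.some.injEq] at h
    exact he _ (steadySeq_lt _) _ (steadySeq_lt _) h
  constructor
  · intro h
    obtain ⟨i, n, hn, hlen, h⟩ := h.exists_getElem?_eq
    simp only [List.length_map, List.length_range] at hlen
    exact steadySeq_squareFree hn i fun t ht => hget _ _ (by omega) (by omega) (h t ht)
  · rintro v ⟨P, x, S, hw, rfl⟩ h
    obtain ⟨i, n, hn, hlen, h⟩ := h.exists_getElem?_eq
    have hN : N = P.length + 1 + S.length := by
      have := congrArg List.length hw
      simp at this
      omega
    simp only [List.length_append] at hlen
    have hleft : ∀ j < P.length, (P ++ S)[j]?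
        = ((List.range N).map fun i => e (steadySeq i))[j]? := by
      intro j hj
      rw [hw, List.append_assoc, List.getElem?_append_left hj, List.getElem?_append_left hj]
    have hright : ∀ j, P.length ≤ j → (P ++ S)[j]?
        = ((List.range N).map fun i => e (steadySeq i))[j + 1]? := by
      intro j hj
      rw [hw, List.getElem?_append_right hj, List.getElem?_append_right (by simp; omega)]
      congr 1
      simp
    have hll : ∀ t < n, i + t + n < P.length → steadySeq (i + t) = steadySeq (i + t + n) := by
      intro t ht h1
      refine hget _ _ (by omega) (by omega) ?_
      rw [← hleft _ (by omega), ← hleft _ (by omega), h t ht]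
    have hlr : ∀ t < n, i + t < P.length → P.length ≤ i + t + n →
        steadySeq (i + t) = steadySeq (i + t + (n + 1)) := by
      intro t ht h1 h2
      refine hget _ _ (by omega) (by omega) ?_
      rw [← hleft _ (by omega), h t ht, hright _ h2]
      rfl
    have hrr : ∀ t < n, P.length ≤ i + t →
        steadySeq (i + t + 1) = steadySeq (i + t + n + 1) := by
      intro t ht h1
      refine hget _ _ (by omega) (by omega) ?_
      rw [← hright _ (by omega), ← hright _ (by omega), h t ht]
    -- The deleted position lies before the square, in its left half, in its right half, or after
    -- it.
    by_cases h1 : P.length ≤ i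
    · refine steadySeq_squareFree hn (i + 1) fun t ht => ?_
      convert hrr t ht (by omega) using 2 <;> omega
    · by_cases h2 : P.length < i + n
      · refine steadySeq_no_square_delete_left hn i (P.length - i) (by omega)
          (fun t ht => hlr t (by omega) (by omega) (by omega)) fun t ht => ?_
        convert hrr (P.length - i + t) (by omega) (by omega) using 2 <;> omega
      · by_cases h3 : P.length ≤ i + 2 * n
        · refine steadySeq_no_square_delete_right hn i (P.length - i - n) (by omega)
            (fun t ht => hll t (by omega) (by omega)) fun t ht => ?_
          convert hlr (P.length - i - n + t) (by omega) (by omega) (by omega) using 2 <;> omega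
        · exact steadySeq_squareFree hn i fun t ht => hll t ht (by omega)

theorem theorem2p1 {A : Type*} [Fintype A] (hA : Fintype.card A = 4) (N : ℕ) :
    ∃ w : List A, N ≤ w.length ∧ IsSteady w := by
  let f : Fin 4 ≃ A := (Fintype.equivFinOfCardEq hA).symm
  refine ⟨_, by simp, isSteady_map_steadySeq (fun x => f (Fin.ofNat 4 x)) ?_ N⟩
  intro x hx y hy h
  have h1 := congrArg Fin.val (f.injective h)
  simp only [Fin.val_ofNat] at h1
  omega
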